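/- Let $W=\{W(t),\,t\ge 0\}$ be a standard Brownian motion on a probability space $(\Omega,\mathcal F,\mathbf P)$, with almost surely continuous paths, and put $$\Psi(x)=\int_x^\infty e^{-u^2/2}\,\frac{du}{\sqrt{2\pi}},\qquad x\in\mathbf R .$$ Let $0<a<b<\infty$. Then for every $c>0$ and every real $M$, the set $\{\inf_{a\le t\le b}|W(t)-M|\ge c\}$ is an event (up to a $\mathbf P$-null set), the integral below converges absolutely, and $$\mathbf P\Big\{\inf_{a\le t\le b}|W(t)-M|\ge c\Big\}=\int_{|v|>c}\Big[1-2\Psi\Big(\frac{|v|-c}{\sqrt{b-a}}\Big)\Big]\,\frac{e^{-(M+v)^2/(2a)}}{\sqrt{2\pi a}}\,dv .$$ -/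

import Mathlib

open MeasureTheory ProbabilityTheory
open scoped NNReal

/-- The tail `Ψ(x) = ∫_x^∞ e^{-u²/2} du / √(2π)` of the standard Gaussian distribution. -/
noncomputable def gaussianTail (x : ℝ) : ℝ :=
  ∫ u in Set.Ioi x, Real.exp (-u ^ 2 / 2) / Real.sqrt (2 * Real.pi)

open Filter Topology
open scoped ENNReal

/-! Put `V = W(a) - M`. By the intermediate value theorem, a continuous path at distance at least `c
> 0` from `M` on `[a, b]` stays on one side of `M`. So either the increment `W(a + t) - W(a)` stays
below `-c - V` for `t ≤ b - a`, or its negative stays below `V - c`; the cases are disjoint. The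
increment process and its negative are Brownian and independent of `V`, so one may freeze `V = v`
and integrate over its law, Gaussian with mean `-M` and variance `a`. For `|v| > c` exactly one
level is positive, namely `|v| - c`, and the reflection principle gives `1 - 2Ψ((|v| - c)/√(b -
a))`; for `|v| < c` both levels are negative and already fail at `t = 0`.

The reflection principle (`measure_exists_le_lt`) is obtained from walks with symmetric increments
on uniform grids, where the overshoot at first passage is the only error and vanishes with the mesh.
-/

/-- A Brownian motion is indistinguishable from a pre-Brownian process all of whose paths are
continuous and all of whose coordinates are measurable. -/
theorem ProbabilityTheory.IsBrownianReal.exists_measurable_continuous {Ω : Type*}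
    [MeasurableSpace Ω] {P : Measure Ω} {W : ℝ≥0 → Ω → ℝ} (hW : IsBrownianReal W P) :
    ∃ B : ℝ≥0 → Ω → ℝ, (∀ t, Measurable (B t)) ∧ (∀ ω, Continuous (B · ω)) ∧
      IsPreBrownianReal B P ∧ ∀ᵐ ω ∂P, ∀ t, W t ω = B t ω := by
  classical
  -- Exceptional sets depend on the time; a countable dense set of times collects them in one null
  -- set `N`, and continuity recovers all other times.
  set d : ℕ → ℝ≥0 := TopologicalSpace.denseSeq ℝ≥0 with hd
  have hdd : DenseRange d := TopologicalSpace.denseRange_denseSeq ℝ≥0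
  have hae : ∀ᵐ ω ∂P, Continuous (W · ω) ∧ ∀ n, W (d n) ω = (hW.aemeasurable (d n)).mk _ ω :=
    hW.cont.and (ae_all_iff.2 fun n => (hW.aemeasurable (d n)).ae_eq_mk)
  obtain ⟨N, hN, hNm, hN0⟩ := exists_measurable_superset_of_null (ae_iff.1 hae)
  have hC : ∀ ω ∈ Nᶜ, Continuous (W · ω) ∧
      ∀ n, W (d n) ω = (hW.aemeasurable (d n)).mk _ ω := by
    intro ω hω
    by_contra h
    exact hω (hN h)
  have hNae : ∀ᵐ ω ∂P, ω ∈ Nᶜ := by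
    rw [ae_iff]; simpa using hN0
  refine ⟨fun t => Nᶜ.indicator (W t), fun t => ?_, fun ω => ?_, ?_, ?_⟩
  · obtain ⟨u, hu, hut⟩ := mem_closure_iff_seq_limit.1 (hdd.closure_range ▸ Set.mem_univ t)
    choose k hk using hu
    refine measurable_of_tendsto_metrizable
      (f := fun n => Nᶜ.indicator ((hW.aemeasurable (d (k n))).mk _))
      (fun n => (AEMeasurable.measurable_mk _).indicator hNm.compl) ?_
    rw [tendsto_pi_nhds]
    intro ω
    by_cases hω : ω ∈ Nᶜ
    · simp only [Set.indicator_of_mem hω]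
      have h := ((hC ω hω).1.tendsto t).comp hut
      refine h.congr fun n => ?_
      rw [Function.comp_apply, ← hk n]
      exact (hC ω hω).2 (k n)
    · simp only [Set.indicator_of_notMem hω]
      exact tendsto_const_nhds
  · by_cases hω : ω ∈ Nᶜ
    · simpa only [Set.indicator_of_mem hω] using (hC ω hω).1
    · simpa only [Set.indicator_of_notMem hω] using continuous_const
  · refine hW.toIsPreBrownianReal.congr fun t => ?_
    filter_upwards [hNae] with ω hω
    rw [Set.indicator_of_mem hω]
  · filter_upwards [hNae] with ω hω t
    rw [Set.indicator_of_mem hω]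

/-! ### Reflection for discrete walks -/

/-- The discrete reflection identity: reflect the walk at the first time it exceeds `y`. -/
theorem measure_exceeds_inter_le_eq_measure_reflected {Ω : Type*} [MeasurableSpace Ω]
    {P : Measure Ω} [IsFiniteMeasure P] {S : ℕ → Ω → ℝ} (hS : ∀ k, Measurable (S k)) (n : ℕ)
    (hind : ∀ k ≤ n, IndepFun (fun ω (j : Set.Iic k) => S j ω) (fun ω => S n ω - S k ω) P)
    (hsym : ∀ k ≤ n, P.map (fun ω => -(S n ω - S k ω)) = P.map (fun ω => S n ω - S k ω))
    (y : ℝ) :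
    P {ω | (∃ k ≤ n, y < S k ω) ∧ S n ω ≤ y} =
      P {ω | ∃ k ≤ n, y < S k ω ∧ (∀ j < k, S j ω ≤ y) ∧ 2 * S k ω - y ≤ S n ω} := by
  set E : ℕ → Set Ω := fun k => {ω | y < S k ω ∧ ∀ j < k, S j ω ≤ y} with hE
  have hEm : ∀ k, MeasurableSet (E k) := fun k => by
    simp only [hE, Set.ofPred_and, Set.ofPred_forall]
    refine (measurableSet_lt measurable_const (hS k)).inter ?_
    exact .iInter fun j => .iInter fun _ => measurableSet_le (hS j) measurable_const
  have hdisj : ∀ i j, i ≠ j → Disjoint (E i) (E j) := by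
    intro i j hij
    rw [Set.disjoint_left]
    rintro ω ⟨h1, h2⟩ ⟨h3, h4⟩
    rcases lt_or_gt_of_ne hij with h | h
    · exact (h4 i h).not_gt h1
    · exact (h2 j h).not_gt h3
  have h1 : {ω | (∃ k ≤ n, y < S k ω) ∧ S n ω ≤ y} =
      ⋃ k ∈ Finset.range (n + 1), E k ∩ {ω | S n ω ≤ y} := by
    classical
    ext ω
    simp only [Set.mem_ofPred_eq, Set.mem_iUnion, Finset.mem_range, Set.mem_inter_iff, exists_prop,
      hE, Nat.lt_succ_iff]
    constructor
    · rintro ⟨h, hn⟩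
      obtain ⟨h3, h4⟩ := Nat.find_spec h
      refine ⟨Nat.find h, h3, ⟨h4, fun j hj => ?_⟩, hn⟩
      have := Nat.find_min h hj
      push Not at this
      exact this (hj.le.trans h3)
    · rintro ⟨k, hk, ⟨h, -⟩, hn⟩
      exact ⟨⟨k, hk, h⟩, hn⟩
  have h2 : {ω | ∃ k ≤ n, y < S k ω ∧ (∀ j < k, S j ω ≤ y) ∧ 2 * S k ω - y ≤ S n ω} =
      ⋃ k ∈ Finset.range (n + 1), E k ∩ {ω | 2 * S k ω - y ≤ S n ω} := by
    ext ω
    simp only [Set.mem_ofPred_eq, Set.mem_iUnion, Finset.mem_range, Set.mem_inter_iff, exists_prop,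
      hE, Nat.lt_succ_iff, and_assoc]
  rw [h1, h2, measure_biUnion_finset, measure_biUnion_finset]
  · refine Finset.sum_congr rfl fun k hk => ?_
    have hk : k ≤ n := Nat.lt_succ_iff.1 (Finset.mem_range.1 hk)
    have hpm : Measurable (fun ω (j : Set.Iic k) => S j ω) :=
      measurable_pi_lambda _ fun j => hS j
    have hDm : Measurable (fun ω => S n ω - S k ω) := (hS n).sub (hS k)
    have hDm' : Measurable (fun ω => -(S n ω - S k ω)) := hDm.neg
    -- Given the path up to `k`, the remaining increment may be negated without changing the joint
    -- law; this turns `S n ≤ y` into `2 * S k - y ≤ S n`.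
    have hneg := ((hind k hk).comp measurable_id measurable_neg).map_prod_eq_prod_map_map
      hpm.aemeasurable hDm.neg.aemeasurable
    have hmap : P.map (fun ω => ((fun j : Set.Iic k => S j ω), S n ω - S k ω)) =
        P.map (fun ω => ((fun j : Set.Iic k => S j ω), -(S n ω - S k ω))) := by
      rw [(hind k hk).map_prod_eq_prod_map_map hpm.aemeasurable hDm.aemeasurable,
        ← hsym k hk]
      exact hneg.symm
    set T : Set ((Set.Iic k → ℝ) × ℝ) :=
      {x | (y < x.1 ⟨k, Set.mem_Iic.2 le_rfl⟩ ∧ ∀ j : Set.Iic k, (j : ℕ) < k → x.1 j ≤ y) ∧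
        x.2 ≤ y - x.1 ⟨k, Set.mem_Iic.2 le_rfl⟩} with hT
    have hTm : MeasurableSet T := by
      simp only [hT, Set.ofPred_and, Set.ofPred_forall]
      refine ((measurableSet_lt (by fun_prop) (by fun_prop)).inter ?_).inter
        (measurableSet_le (by fun_prop) (by fun_prop))
      exact .iInter fun j => .iInter fun _ => measurableSet_le (by fun_prop) (by fun_prop)
    have := DFunLike.congr_fun hmap T
    rw [Measure.map_apply (hpm.prodMk hDm) hTm, Measure.map_apply (hpm.prodMk hDm') hTm] at this
    convert this using 2
    · ext ω
      simp only [hE, hT, Set.mem_inter_iff, Set.mem_ofPred_eq, Set.mem_preimage]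
      refine and_congr (and_congr Iff.rfl ⟨fun h j hj => h j hj,
        fun h j hj => h ⟨j, hj.le⟩ hj⟩) ⟨fun h => by linarith, fun h => by linarith⟩
    · ext ω
      simp only [hE, hT, Set.mem_inter_iff, Set.mem_ofPred_eq, Set.mem_preimage]
      refine and_congr (and_congr Iff.rfl ⟨fun h j hj => h j hj,
        fun h j hj => h ⟨j, hj.le⟩ hj⟩) ⟨fun h => by linarith, fun h => by linarith⟩
  · exact fun i _ j _ hij => (hdisj i j hij).mono Set.inter_subset_left Set.inter_subset_left
  · exact fun k _ => (hEm k).inter (measurableSet_le (by fun_prop) (hS n))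
  · exact fun i _ j _ hij => (hdisj i j hij).mono Set.inter_subset_left Set.inter_subset_left
  · exact fun k _ => (hEm k).inter (measurableSet_le (hS n) measurable_const)

/-- Upper half of the discrete reflection principle. -/
theorem measure_exceeds_le_two_mul {Ω : Type*} [MeasurableSpace Ω]
    {P : Measure Ω} [IsFiniteMeasure P] {S : ℕ → Ω → ℝ} (hS : ∀ k, Measurable (S k)) (n : ℕ)
    (hind : ∀ k ≤ n, IndepFun (fun ω (j : Set.Iic k) => S j ω) (fun ω => S n ω - S k ω) P)
    (hsym : ∀ k ≤ n, P.map (fun ω => -(S n ω - S k ω)) = P.map (fun ω => S n ω - S k ω))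
    (y : ℝ) :
    P {ω | ∃ k ≤ n, y < S k ω} ≤ 2 * P {ω | y < S n ω} := by
  calc P {ω | ∃ k ≤ n, y < S k ω}
      ≤ P ({ω | (∃ k ≤ n, y < S k ω) ∧ S n ω ≤ y} ∪ {ω | y < S n ω}) := by
        refine measure_mono fun ω hω => ?_
        rcases le_or_gt (S n ω) y with h | h
        · exact Or.inl ⟨hω, h⟩
        · exact Or.inr h
    _ ≤ P {ω | (∃ k ≤ n, y < S k ω) ∧ S n ω ≤ y} + P {ω | y < S n ω} := measure_union_le _ _
    _ ≤ P {ω | y < S n ω} + P {ω | y < S n ω} := by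
        rw [measure_exceeds_inter_le_eq_measure_reflected hS n hind hsym]
        gcongr
        rintro ⟨k, -, h1, -, h2⟩
        linarith
    _ = 2 * P {ω | y < S n ω} := (two_mul _).symm

/-- Lower half of the discrete reflection principle, with an error term for the overshoot. -/
theorem add_measure_le_measure_exceeds_add {Ω : Type*} [MeasurableSpace Ω]
    {P : Measure Ω} [IsFiniteMeasure P] {S : ℕ → Ω → ℝ} (hS : ∀ k, Measurable (S k)) (n : ℕ)
    (hind : ∀ k ≤ n, IndepFun (fun ω (j : Set.Iic k) => S j ω) (fun ω => S n ω - S k ω) P)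
    (hsym : ∀ k ≤ n, P.map (fun ω => -(S n ω - S k ω)) = P.map (fun ω => S n ω - S k ω))
    {y ε : ℝ} (h0 : ∀ᵐ ω ∂P, S 0 ω ≤ y) (hε : 0 ≤ ε) :
    P {ω | y < S n ω} + P {ω | y + 2 * ε < S n ω} ≤
      P {ω | ∃ k ≤ n, y < S k ω} + P {ω | ∃ k < n, ε < |S (k + 1) ω - S k ω|} := by
  have hle : P {ω | y + 2 * ε < S n ω} ≤
      P {ω | (∃ k ≤ n, y < S k ω) ∧ S n ω ≤ y} +
        P {ω | ∃ k < n, ε < |S (k + 1) ω - S k ω|} := by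
    rw [measure_exceeds_inter_le_eq_measure_reflected hS n hind hsym]
    refine (measure_mono_ae ?_).trans (measure_union_le _ _)
    filter_upwards [h0] with ω hω0 (hω : y + 2 * ε < S n ω)
    by_cases hstep : ∃ k < n, ε < |S (k + 1) ω - S k ω|
    · exact Or.inr hstep
    · left
      classical
      push Not at hstep
      have hex : ∃ k, k ≤ n ∧ y < S k ω := ⟨n, le_rfl, by linarith⟩
      obtain ⟨h3, h4⟩ := Nat.find_spec hex
      have hmin : ∀ j < Nat.find hex, S j ω ≤ y := fun j hj => by
        have := Nat.find_min hex hj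
        push Not at this
        exact this (hj.le.trans h3)
      refine ⟨Nat.find hex, h3, h4, hmin, ?_⟩
      -- First passage is not at `0`, so its overshoot is at most one step, hence at most `ε`, and
      -- `2 * S k - y ≤ y + 2 * ε`.
      obtain ⟨m, hm⟩ : ∃ m, Nat.find hex = m + 1 := by
        refine Nat.exists_eq_succ_of_ne_zero fun h => ?_
        rw [h] at h4
        linarith
      rw [hm] at h3 hmin ⊢
      have h5 := hmin m (Nat.lt_succ_self m)
      have h6 := (abs_le.1 (hstep m h3)).2
      linarith
  have hsplit : P {ω | ∃ k ≤ n, y < S k ω} =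
      P {ω | y < S n ω} + P {ω | (∃ k ≤ n, y < S k ω) ∧ S n ω ≤ y} := by
    have hm : MeasurableSet {ω | y < S n ω} := measurableSet_lt measurable_const (hS n)
    rw [← measure_inter_add_sdiff _ hm]
    congr 2
    · ext ω
      exact ⟨fun h => h.2, fun h => ⟨⟨n, le_rfl, h⟩, h⟩⟩
    · ext ω
      simp
  rw [hsplit, add_assoc]
  gcongr

/-! ### From grids to the continuous reflection principle -/

/-- The increment of a pre-Brownian motion over `[s, t]` is independent of the values at
any family of times before `s`. -/
theorem ProbabilityTheory.IsPreBrownianReal.indepFun_comp_sub {Ω : Type*} [MeasurableSpace Ω]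
    {P : Measure Ω} {B : ℝ≥0 → Ω → ℝ} (hB : IsPreBrownianReal B P) {ι : Type*} (u : ι → ℝ≥0)
    {s t : ℝ≥0} (hu : ∀ i, u i ≤ s) (hst : s ≤ t) :
    IndepFun (fun ω i => B (u i) ω) (fun ω => B t ω - B s ω) P := by
  have hψ : Measurable fun x : ℝ≥0 → ℝ => x (t - s) := measurable_pi_apply _
  have h := (hB.indepFun_shift s).symm.comp
    (φ := fun (x : Set.Iic s → ℝ) i => x ⟨u i, hu i⟩) (ψ := fun x : ℝ≥0 → ℝ => x (t - s))
    (by fun_prop) hψ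
  simpa only [Function.comp_def, add_tsub_cancel_of_le hst] using h

theorem ProbabilityTheory.IsPreBrownianReal.map_neg_sub {Ω : Type*} [MeasurableSpace Ω]
    {P : Measure Ω} {B : ℝ≥0 → Ω → ℝ} (hB : IsPreBrownianReal B P) (s t : ℝ≥0) :
    P.map (fun ω => -(B t ω - B s ω)) = P.map (fun ω => B t ω - B s ω) := by
  have h := hB.hasLaw_sub t s
  have h' := (gaussianReal_neg h).map_eq
  rw [neg_zero] at h'
  exact h'.trans h.map_eq.symm

/-- Points of the uniform grids of `[0, T]` approximate every `t ≤ T`. -/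
theorem exists_tendsto_uniform_grid {T t : ℝ≥0} (hT : 0 < T) (ht : t ≤ T) :
    ∃ k : ℕ → ℕ, (∀ n, k n ≤ n + 1) ∧
      Tendsto (fun n : ℕ => (k n : ℝ≥0) * (T / (n + 1 : ℕ))) atTop (𝓝 t) := by
  have hT' : (0 : ℝ) < T := hT
  refine ⟨fun n => ⌊(t / T : ℝ) * (n + 1 : ℕ)⌋₊, fun n => ?_, ?_⟩
  · refine Nat.floor_le_of_le ?_
    refine mul_le_of_le_one_left (Nat.cast_nonneg _) ((div_le_one hT').2 ?_)
    exact_mod_cast ht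
  · rw [← NNReal.tendsto_coe]
    have h := (tendsto_nat_floor_mul_div_atTop (R := ℝ) (a := t / T) (by positivity)).comp
      (tendsto_natCast_atTop_atTop.comp (tendsto_add_atTop_nat 1))
    have h2 := h.mul_const (T : ℝ)
    rw [div_mul_cancel₀ _ hT'.ne'] at h2
    refine h2.congr fun n => ?_
    simp only [Function.comp_apply]
    push_cast
    ring

/-- A continuous path exceeds `y` before time `T` iff it does so on all fine enough grids. -/
theorem grid_exceeds_measurable_and_eventually_iff {Ω : Type*} [MeasurableSpace Ω] {B : ℝ≥0 → Ω → ℝ}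
    (hBm : ∀ t, Measurable (B t)) (hBc : ∀ ω, Continuous (B · ω)) {T : ℝ≥0} (hT : 0 < T)
    (y : ℝ) :
    (∀ n : ℕ, MeasurableSet {ω | ∃ k ≤ n + 1, y < B (k * (T / (n + 1 : ℕ))) ω}) ∧
    ∀ ω, ∀ᶠ n : ℕ in atTop, ω ∈ {ω | ∃ k ≤ n + 1, y < B (k * (T / (n + 1 : ℕ))) ω} ↔
      ω ∈ {ω | ∃ t ≤ T, y < B t ω} := by
  refine ⟨fun n => ?_, fun ω => ?_⟩
  · simp only [Set.ofPred_exists, Set.ofPred_and]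
    refine .iUnion fun k => MeasurableSet.inter (.const _) (measurableSet_lt measurable_const (hBm _))
  · have himp : ∀ n : ℕ, (∃ k ≤ n + 1, y < B (k * (T / (n + 1 : ℕ))) ω) →
        ∃ t ≤ T, y < B t ω := by
      rintro n ⟨k, hk, hy⟩
      refine ⟨_, ?_, hy⟩
      calc (k : ℝ≥0) * (T / (n + 1 : ℕ)) ≤ (n + 1 : ℕ) * (T / (n + 1 : ℕ)) := by gcongr
        _ = T := mul_div_cancel₀ _ (by positivity)
    by_cases hω : ∃ t ≤ T, y < B t ω
    · obtain ⟨t, htT, hy⟩ := hω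
      obtain ⟨k, hk, hkt⟩ := exists_tendsto_uniform_grid hT htT
      filter_upwards [(((hBc ω).tendsto t).comp hkt).eventually (lt_mem_nhds hy)] with n hn
      exact ⟨himp n, fun _ => ⟨k n, hk n, hn⟩⟩
    · exact .of_forall fun n => ⟨himp n, fun h => (hω h).elim⟩

/-- **Reflection principle** for Brownian motion. -/
theorem ProbabilityTheory.IsPreBrownianReal.measure_exists_le_lt {Ω : Type*} [MeasurableSpace Ω]
    {P : Measure Ω} {B : ℝ≥0 → Ω → ℝ} (hB : IsPreBrownianReal B P)
    (hBm : ∀ t, Measurable (B t)) (hBc : ∀ ω, Continuous (B · ω)) {T : ℝ≥0} (hT : 0 < T)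
    {y : ℝ} (hy : 0 ≤ y) :
    P {ω | ∃ t ≤ T, y < B t ω} = 2 * P {ω | y < B T ω} := by
  have := hB.isGaussianProcess.isProbabilityMeasure
  obtain ⟨hAm, hAlim⟩ := grid_exceeds_measurable_and_eventually_iff hBm hBc hT y
  have hA := tendsto_measure_of_tendsto_indicator_of_isFiniteMeasure atTop P hAm hAlim
  have hmono : ∀ n k : ℕ, k ≤ n + 1 → (k : ℝ≥0) * (T / (n + 1 : ℕ)) ≤ T := fun n k hk =>
    calc (k : ℝ≥0) * (T / (n + 1 : ℕ)) ≤ (n + 1 : ℕ) * (T / (n + 1 : ℕ)) := by gcongr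
      _ = T := mul_div_cancel₀ _ (by positivity)
  have hend : ∀ n : ℕ, ((n + 1 : ℕ) : ℝ≥0) * (T / (n + 1 : ℕ)) = T := fun n =>
    mul_div_cancel₀ _ (by positivity)
  have hSm : ∀ n k : ℕ, Measurable (B (k * (T / (n + 1 : ℕ)))) := fun n k => hBm _
  have hind : ∀ n : ℕ, ∀ k : ℕ, k ≤ n + 1 → IndepFun
      (fun ω (j : Set.Iic k) => B (((j : ℕ) : ℝ≥0) * (T / (n + 1 : ℕ))) ω)
      (fun ω => B (((n + 1 : ℕ) : ℝ≥0) * (T / (n + 1 : ℕ))) ω - B (k * (T / (n + 1 : ℕ))) ω) P := by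
    intro n k hk
    refine hB.indepFun_comp_sub (fun j : Set.Iic k => ((j : ℕ) : ℝ≥0) * (T / (n + 1 : ℕ)))
      (fun j => ?_) ?_
    · have : j.1 ≤ k := j.2
      gcongr
    · gcongr
  have hsym := fun n k : ℕ => hB.map_neg_sub ((k : ℝ≥0) * (T / (n + 1 : ℕ)))
    (((n + 1 : ℕ) : ℝ≥0) * (T / (n + 1 : ℕ)))
  refine le_antisymm (le_of_tendsto' hA fun n => ?_) ?_
  · have h := measure_exceeds_le_two_mul (hSm n) (n + 1) (hind n) (fun k _ => hsym n k) y
    rwa [hend] at h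
  · have hlow : ∀ ε > 0, P {ω | y < B T ω} + P {ω | y + 2 * ε < B T ω} ≤
        P {ω | ∃ t ≤ T, y < B t ω} := by
      intro ε hε
      -- Uniform continuity on `[0, T]` rules out grid steps larger than `ε` eventually, path by
      -- path.
      have hstep : Tendsto (fun n : ℕ => P {ω | ∃ k < n + 1,
          ε < |B (((k + 1 : ℕ) : ℝ≥0) * (T / (n + 1 : ℕ))) ω - B (k * (T / (n + 1 : ℕ))) ω|}) atTop
          (𝓝 (P ∅)) := by
        refine tendsto_measure_of_tendsto_indicator_of_isFiniteMeasure atTop P (fun n => ?_)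
          fun ω => ?_
        · simp only [Set.ofPred_exists, Set.ofPred_and]
          exact .iUnion fun k => MeasurableSet.inter (.const _)
            (measurableSet_lt measurable_const ((hBm _).sub (hBm _)).abs)
        · have huc := (isCompact_Icc (a := (0 : ℝ≥0)) (b := T)).uniformContinuousOn_of_continuous
            (hBc ω).continuousOn
          obtain ⟨δ, hδ, H⟩ := Metric.uniformContinuousOn_iff.1 huc ε hε
          have hmesh : Tendsto (fun n : ℕ => (T : ℝ) / (n + 1 : ℕ)) atTop (𝓝 0) :=
            (tendsto_const_div_atTop_nhds_zero_nat (T : ℝ)).comp (tendsto_add_atTop_nat 1)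
          filter_upwards [hmesh.eventually (gt_mem_nhds hδ)] with n hn
          simp only [Set.mem_empty_iff_false, iff_false]
          rintro ⟨k, hk, hk'⟩
          have := H _ ⟨zero_le, hmono n (k + 1) hk⟩ _ ⟨zero_le, hmono n k hk.le⟩ (by
            rw [NNReal.dist_eq]
            push_cast at hn ⊢
            rw [← sub_mul, add_sub_cancel_left, one_mul, abs_of_nonneg (by positivity)]
            exact hn)
          rw [Real.dist_eq] at this
          exact this.not_gt hk'
      refine ge_of_tendsto' (by simpa only [measure_empty, add_zero] using hA.add hstep) fun n => ?_
      have h := add_measure_le_measure_exceeds_add (hSm n) (n + 1) (hind n)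
        (fun k _ => hsym n k) (y := y) (by
          filter_upwards [hB.eval_zero_ae_eq_zero] with ω hω
          simpa [hω] using hy) hε.le
      rwa [hend] at h
    -- Let `ε` tend to `0`: the strict events increase to `{y < B T}`.
    have hlim : Tendsto (fun n : ℕ => P {ω | y + 2 * (1 / ((n : ℝ) + 1)) < B T ω}) atTop
        (𝓝 (P {ω | y < B T ω})) := by
      refine tendsto_measure_of_tendsto_indicator_of_isFiniteMeasure atTop P
        (fun n => measurableSet_lt measurable_const (hBm T)) fun ω => ?_
      by_cases hω : y < B T ω
      · have h2 : Tendsto (fun n : ℕ => y + 2 * (1 / ((n : ℝ) + 1))) atTop (𝓝 y) := by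
          simpa using (tendsto_one_div_add_atTop_nhds_zero_nat (𝕜 := ℝ)).const_mul 2 |>.const_add y
        filter_upwards [h2.eventually (gt_mem_nhds hω)] with n hn
        exact ⟨fun _ => hω, fun _ => hn⟩
      · refine .of_forall fun n => ⟨fun h => ?_, fun h => (hω h).elim⟩
        refine (lt_of_le_of_lt ?_ h : y < B T ω)
        have : (0 : ℝ) ≤ 2 * (1 / ((n : ℝ) + 1)) := by positivity
        linarith
    rw [two_mul]
    exact le_of_tendsto' (hlim.const_add _) fun n => hlow _ (by positivity)

/-! ### Gaussian tails -/

theorem gaussianTail_eq_gaussianReal_Ioi (x : ℝ) :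
    gaussianTail x = (gaussianReal 0 1).real (Set.Ioi x) := by
  rw [measureReal_def, gaussianReal_apply_eq_integral _ one_ne_zero, ENNReal.toReal_ofReal
    (integral_nonneg fun _ => gaussianPDFReal_nonneg _ _ _)]
  unfold gaussianTail
  congr 1 with u
  simp [gaussianPDFReal]
  ring

theorem antitone_gaussianTail : Antitone gaussianTail := fun x y hxy => by
  simp only [gaussianTail_eq_gaussianReal_Ioi]
  exact measureReal_mono (Set.Ioi_subset_Ioi hxy)

theorem ProbabilityTheory.HasLaw.measureReal_lt_eq_gaussianTail {Ω : Type*} [MeasurableSpace Ω]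
    {P : Measure Ω} {Y : Ω → ℝ} {v : ℝ≥0} (hY : HasLaw Y (gaussianReal 0 v) P) (hv : 0 < v)
    (y : ℝ) : P.real {ω | y < Y ω} = gaussianTail (y / √(v : ℝ)) := by
  have hs : 0 < √(v : ℝ) := Real.sqrt_pos.2 hv
  have h := gaussianReal_div_const hY √(v : ℝ)
  have hvar : v / NNReal.mk (√(v : ℝ) ^ 2) (sq_nonneg _) = 1 := by
    have hmk : NNReal.mk (√(v : ℝ) ^ 2) (sq_nonneg _) = v := NNReal.eq (Real.sq_sqrt v.2)
    rw [hmk, div_self hv.ne']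
  rw [hvar, zero_div] at h
  rw [gaussianTail_eq_gaussianReal_Ioi, ← h.map_eq, measureReal_def, measureReal_def,
    Measure.map_apply_of_aemeasurable h.aemeasurable measurableSet_Ioi]
  congr 2
  ext ω
  exact (div_lt_div_iff_of_pos_right hs).symm

/-! ### Staying below a level, fixed or random -/

/-- A continuous function is bounded by `y` on `[0, T]` iff it is so at a dense sequence of
times truncated at `T`. -/
theorem forall_le_iff_forall_denseSeq {f : ℝ≥0 → ℝ} (hf : Continuous f) (T : ℝ≥0) (y : ℝ) :
    (∀ t ≤ T, f t ≤ y) ↔ ∀ n, f (min (TopologicalSpace.denseSeq ℝ≥0 n) T) ≤ y := by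
  refine ⟨fun h n => h _ (min_le_right _ _), fun h t ht => ?_⟩
  have hcl : IsClosed {s : ℝ≥0 | f (min s T) ≤ y} := isClosed_le (by fun_prop) continuous_const
  have hsub : Set.range (TopologicalSpace.denseSeq ℝ≥0) ⊆ {s : ℝ≥0 | f (min s T) ≤ y} :=
    Set.range_subset_iff.2 h
  have huniv := (Dense.mono hsub (TopologicalSpace.denseRange_denseSeq ℝ≥0)).closure_eq
  rw [hcl.closure_eq] at huniv
  have : t ∈ {s : ℝ≥0 | f (min s T) ≤ y} := huniv ▸ Set.mem_univ t
  simpa [min_eq_left ht] using this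

theorem measurableSet_forall_le {Ω : Type*} [MeasurableSpace Ω] {X : ℝ≥0 → Ω → ℝ}
    (hXm : ∀ t, Measurable (X t)) (hXc : ∀ ω, Continuous (X · ω)) (T : ℝ≥0) {U : Ω → ℝ}
    (hU : Measurable U) : MeasurableSet {ω | ∀ t ≤ T, X t ω ≤ U ω} := by
  simp only [fun ω => forall_le_iff_forall_denseSeq (hXc ω) T (U ω), Set.ofPred_forall]
  exact .iInter fun n => measurableSet_le (hXm _) hU

/-- Conditioning on an independent boundary level. -/
theorem measure_forall_le_comp_eq_lintegral {Ω : Type*} [MeasurableSpace Ω] {P : Measure Ω}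
    [IsFiniteMeasure P] {X : ℝ≥0 → Ω → ℝ} (hXm : ∀ t, Measurable (X t))
    (hXc : ∀ ω, Continuous (X · ω)) {V : Ω → ℝ} (hV : Measurable V)
    (hind : IndepFun (fun ω t => X t ω) V P) (T : ℝ≥0) {g : ℝ → ℝ} (hg : Measurable g) :
    P {ω | ∀ t ≤ T, X t ω ≤ g (V ω)} = ∫⁻ v, P {ω | ∀ t ≤ T, X t ω ≤ g v} ∂(P.map V) := by
  set d := TopologicalSpace.denseSeq ℝ≥0
  have hξm : Measurable (fun ω n => X (min (d n) T) ω) := measurable_pi_lambda _ fun n => hXm _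
  have hφ : Measurable fun (x : ℝ≥0 → ℝ) (n : ℕ) => x (min (d n) T) :=
    measurable_pi_lambda _ fun n => measurable_pi_apply _
  have hind' : IndepFun (fun ω n => X (min (d n) T) ω) V P := hind.comp hφ measurable_id
  set E : Set ((ℕ → ℝ) × ℝ) := {p | ∀ n, p.1 n ≤ g p.2} with hE
  have hEm : MeasurableSet E := by
    simp only [hE, Set.ofPred_forall]
    exact .iInter fun n => measurableSet_le (by fun_prop) (by fun_prop)
  have h := DFunLike.congr_fun
    (hind'.map_prod_eq_prod_map_map hξm.aemeasurable hV.aemeasurable) E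
  rw [Measure.map_apply (hξm.prodMk hV) hEm, Measure.prod_apply_symm hEm] at h
  simp only [fun ω u => forall_le_iff_forall_denseSeq (hXc ω) T u]
  refine h.trans (lintegral_congr fun v => ?_)
  rw [Measure.map_apply hξm (measurable_prodMk_right hEm)]
  rfl

/-- The probability that a Brownian motion stays below a level. -/
theorem ProbabilityTheory.IsPreBrownianReal.measureReal_forall_le {Ω : Type*} [MeasurableSpace Ω]
    {P : Measure Ω} {B : ℝ≥0 → Ω → ℝ} (hB : IsPreBrownianReal B P)
    (hBm : ∀ t, Measurable (B t)) (hBc : ∀ ω, Continuous (B · ω)) {T : ℝ≥0} (hT : 0 < T)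
    {y : ℝ} (hy : 0 ≤ y) :
    P.real {ω | ∀ t ≤ T, B t ω ≤ y} = 1 - 2 * gaussianTail (y / √(T : ℝ)) := by
  have := hB.isGaussianProcess.isProbabilityMeasure
  have hm := measurableSet_forall_le hBm hBc T (measurable_const (a := y))
  have hc : {ω | ∃ t ≤ T, y < B t ω} = {ω | ∀ t ≤ T, B t ω ≤ y}ᶜ := by
    ext ω; simp
  have h := hB.measure_exists_le_lt hBm hBc hT hy
  rw [hc] at h
  have h' := congrArg ENNReal.toReal h
  rw [ENNReal.toReal_mul, ← measureReal_def, ← measureReal_def,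
    (hB.hasLaw_eval T).measureReal_lt_eq_gaussianTail hT, probReal_compl_eq_one_sub hm] at h'
  simp at h'
  linarith

/-- The process starts at `0` almost surely, which already violates a negative level. -/
theorem ProbabilityTheory.IsPreBrownianReal.measure_forall_le_eq_zero {Ω : Type*}
    [MeasurableSpace Ω] {P : Measure Ω} {B : ℝ≥0 → Ω → ℝ} (hB : IsPreBrownianReal B P) (T : ℝ≥0)
    {y : ℝ} (hy : y < 0) : P {ω | ∀ t ≤ T, B t ω ≤ y} = 0 := by
  refine measure_mono_null (fun ω hω => ?_) (ae_iff.1 hB.eval_zero_ae_eq_zero)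
  exact ((hω 0 zero_le).trans_lt hy).ne

/-! ### Avoiding a band, and the formula -/

/-- A continuous path avoids `(-c, c)` on `[0, T]` iff it stays on one side. -/
theorem forall_le_abs_iff_of_continuous {f : ℝ≥0 → ℝ} (hf : Continuous f) {c : ℝ} (hc : 0 < c)
    (T : ℝ≥0) :
    (∀ t ≤ T, c ≤ |f t|) ↔ (∀ t ≤ T, f t ≤ -c) ∨ (∀ t ≤ T, c ≤ f t) := by
  constructor
  · intro h
    have hne : ∀ t ≤ T, f t ≠ 0 := fun t ht h0 => by
      have := h t ht
      rw [h0, abs_zero] at this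
      exact this.not_gt hc
    rcases lt_or_ge (f 0) 0 with h0 | h0
    · refine Or.inl fun t ht => ?_
      rcases le_abs.1 (h t ht) with h1 | h1
      · obtain ⟨s, hs, hs0⟩ := intermediate_value_Icc (zero_le (a := t)) hf.continuousOn
          ⟨h0.le, hc.le.trans h1⟩
        exact (hne s (hs.2.trans ht) hs0).elim
      · linarith
    · refine Or.inr fun t ht => ?_
      rcases le_abs.1 (h t ht) with h1 | h1
      · exact h1
      · obtain ⟨s, hs, hs0⟩ := intermediate_value_Icc' (zero_le (a := t)) hf.continuousOn
          ⟨by linarith, h0⟩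
        exact (hne s (hs.2.trans ht) hs0).elim
  · rintro (h | h) t ht
    · exact le_abs.2 (Or.inr (by linarith [h t ht]))
    · exact le_abs.2 (Or.inl (h t ht))

theorem le_iInf_abs_sub_iff {f : ℝ≥0 → ℝ} (hf : Continuous f) {a b : ℝ≥0} (hab : a ≤ b) {c : ℝ}
    (hc : 0 < c) (M : ℝ) :
    c ≤ ⨅ t : Set.Icc a b, |f t - M| ↔
      (∀ t ≤ b - a, f (a + t) - f a ≤ -c - (f a - M)) ∨
        ∀ t ≤ b - a, -(f (a + t) - f a) ≤ (f a - M) - c := by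
  have : Nonempty (Set.Icc a b) := ⟨⟨a, le_rfl, hab⟩⟩
  have hbdd : BddBelow (Set.range fun t : Set.Icc a b => |f t - M|) :=
    ⟨0, Set.forall_mem_range.2 fun _ => abs_nonneg _⟩
  have hshift : (∀ t : Set.Icc a b, c ≤ |f t - M|) ↔ ∀ t ≤ b - a, c ≤ |f (a + t) - M| := by
    refine ⟨fun h t ht => h ⟨a + t, le_self_add, ?_⟩, fun h t => ?_⟩
    · exact (add_le_add_right ht a).trans_eq (add_tsub_cancel_of_le hab)
    · have := h (t - a) (tsub_le_tsub_right t.2.2 a)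
      rwa [add_tsub_cancel_of_le t.2.1] at this
  rw [le_ciInf_iff hbdd, hshift, forall_le_abs_iff_of_continuous (by fun_prop) hc]
  refine or_congr (forall₂_congr fun t _ => ?_) (forall₂_congr fun t _ => ?_)
  · constructor <;> intro <;> linarith
  · constructor <;> intro <;> linarith

/-- Times are elements of `ℝ≥0`, and `IsBrownianReal W P` says that `W` is a standard Brownian
motion: its finite-dimensional laws are the centred Gaussian ones with covariance `min s t`, and
almost every path is continuous on `ℝ≥0`. Besides the formula, the conclusion records that the event
is an event of the completed probability space and that the integral converges. -/
theorem lemma2p1 {Ω : Type*} [MeasurableSpace Ω] (P : Measure Ω) [IsProbabilityMeasure P]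
    (W : ℝ≥0 → Ω → ℝ) (hW : IsBrownianReal W P)
    (a b : ℝ≥0) (ha : 0 < a) (hab : a < b) (c : ℝ) (hc : 0 < c) (M : ℝ) :
    NullMeasurableSet {ω | c ≤ ⨅ t : Set.Icc a b, |W t ω - M|} P ∧
    IntegrableOn
      (fun v : ℝ => (1 - 2 * gaussianTail ((|v| - c) / Real.sqrt ((b : ℝ) - a))) *
        (Real.exp (-(M + v) ^ 2 / (2 * a)) / Real.sqrt (2 * Real.pi * a)))
      {v : ℝ | c < |v|} volume ∧
    P.real {ω | c ≤ ⨅ t : Set.Icc a b, |W t ω - M|} =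
      ∫ v in {v : ℝ | c < |v|},
        (1 - 2 * gaussianTail ((|v| - c) / Real.sqrt ((b : ℝ) - a))) *
          (Real.exp (-(M + v) ^ 2 / (2 * a)) / Real.sqrt (2 * Real.pi * a)) := by
  obtain ⟨B, hBm, hBc, hB, hWB⟩ := hW.exists_measurable_continuous
  set T : ℝ≥0 := b - a with hTdef
  have hT : 0 < T := tsub_pos_of_lt hab
  have hTr : (b : ℝ) - a = (T : ℝ) := (NNReal.coe_sub hab.le).symm
  set X : ℝ≥0 → Ω → ℝ := fun t ω => B (a + t) ω - B a ω with hX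
  have hXB : IsPreBrownianReal X P := hB.shift a
  have hXm : ∀ t, Measurable (X t) := fun t => (hBm _).sub (hBm _)
  have hXc : ∀ ω, Continuous (X · ω) := fun ω => by
    have := hBc ω
    simp only [hX]
    fun_prop
  have hNB : IsPreBrownianReal (-X) P := hXB.neg
  have hNm : ∀ t, Measurable ((-X) t) := fun t => (hXm t).neg
  have hNc : ∀ ω, Continuous ((-X) · ω) := fun ω => (hXc ω).neg
  set V : Ω → ℝ := fun ω => B a ω - M with hVdef
  have hV : Measurable V := (hBm a).sub_const M
  have hVlaw : P.map V = gaussianReal (-M) a := by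
    have := (gaussianReal_sub_const (hB.hasLaw_eval a) M).map_eq
    rwa [zero_sub] at this
  have hψ : Measurable fun x : Set.Iic a → ℝ => x ⟨a, Set.mem_Iic.2 le_rfl⟩ - M := by
    have : Measurable fun x : Set.Iic a → ℝ => x ⟨a, Set.mem_Iic.2 le_rfl⟩ :=
      measurable_pi_apply _
    exact this.sub_const M
  have hind : IndepFun (fun ω t => X t ω) V P := (hB.indepFun_shift a).comp measurable_id hψ
  have hneg : Measurable fun x : ℝ≥0 → ℝ => fun t => -x t :=
    measurable_pi_lambda _ fun t => (measurable_pi_apply t).neg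
  have hindN : IndepFun (fun ω t => (-X) t ω) V P := hind.comp hneg measurable_id
  set E₁ : Set Ω := {ω | ∀ t ≤ T, X t ω ≤ -c - V ω} with hE₁
  set E₂ : Set Ω := {ω | ∀ t ≤ T, (-X) t ω ≤ V ω - c} with hE₂
  have hE₁m : MeasurableSet E₁ := measurableSet_forall_le hXm hXc T (hV.const_sub _)
  have hE₂m : MeasurableSet E₂ := measurableSet_forall_le hNm hNc T (hV.sub_const _)
  -- At `t = 0` the two events force `V ≤ -c` and `V ≥ c`.
  have hdisj : Disjoint E₁ E₂ := by
    rw [Set.disjoint_left]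
    intro ω h1 h2
    have h3 := h1 0 zero_le
    have h4 := h2 0 zero_le
    simp only [Pi.neg_apply] at h4
    linarith
  have hev : {ω | c ≤ ⨅ t : Set.Icc a b, |W t ω - M|} =ᵐ[P] (E₁ ∪ E₂ : Set Ω) := by
    rw [eventuallyEq_set]
    filter_upwards [hWB] with ω hω
    simp only [hω]
    exact le_iInf_abs_sub_iff (hBc ω) hab.le hc M
  set S : Set ℝ := {v : ℝ | c < |v|} with hS
  have hSm : MeasurableSet S := measurableSet_lt measurable_const continuous_abs.measurable
  set h : ℝ → ℝ := S.indicator fun v => 1 - 2 * gaussianTail ((|v| - c) / √(T : ℝ)) with hh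
  have hmeas : Measurable h := by
    refine Measurable.indicator ?_ hSm
    exact ((antitone_gaussianTail.measurable.comp
      ((continuous_abs.measurable.sub_const c).div_const _)).const_mul 2).const_sub 1
  have hval : ∀ v ∈ S, h v = P.real {ω | ∀ t ≤ T, X t ω ≤ |v| - c} := fun v hv => by
    rw [hh, Set.indicator_of_mem hv, hXB.measureReal_forall_le hXm hXc hT]
    exact sub_nonneg.2 (le_of_lt hv)
  have hvalN : ∀ v ∈ S, h v = P.real {ω | ∀ t ≤ T, (-X) t ω ≤ |v| - c} := fun v hv => by
    rw [hh, Set.indicator_of_mem hv, hNB.measureReal_forall_le hNm hNc hT]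
    exact sub_nonneg.2 (le_of_lt hv)
  have h0 : ∀ v, 0 ≤ h v := fun v => by
    by_cases hv : v ∈ S
    · rw [hval v hv]; exact measureReal_nonneg
    · rw [hh, Set.indicator_of_notMem hv]
  have h1 : ∀ v, h v ≤ 1 := fun v => by
    by_cases hv : v ∈ S
    · rw [hval v hv]; exact measureReal_le_one
    · rw [hh, Set.indicator_of_notMem hv]; exact zero_le_one
  have hbound : ∀ v, ‖h v‖ ≤ 1 := fun v => by
    rw [Real.norm_of_nonneg (h0 v)]; exact h1 v
  have hintegrand : (fun v => gaussianPDFReal (-M) a v * h v) = S.indicator fun v =>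
      (1 - 2 * gaussianTail ((|v| - c) / Real.sqrt ((b : ℝ) - a))) *
        (Real.exp (-(M + v) ^ 2 / (2 * a)) / Real.sqrt (2 * Real.pi * a)) := by
    ext v
    by_cases hv : v ∈ S
    · rw [hh, Set.indicator_of_mem hv, Set.indicator_of_mem hv, hTr, gaussianPDFReal,
        sub_neg_eq_add, add_comm v M]
      ring
    · rw [hh, Set.indicator_of_notMem hv, Set.indicator_of_notMem hv, mul_zero]
  have hint : Integrable (fun v => gaussianPDFReal (-M) a v * h v) volume :=
    (integrable_gaussianPDFReal (-M) a).mul_bdd hmeas.aestronglyMeasurable (ae_of_all _ hbound)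
  have hintγ : Integrable h (gaussianReal (-M) a) :=
    Integrable.of_bound hmeas.aestronglyMeasurable 1 (ae_of_all _ hbound)
  have hsum : ∀ᵐ v ∂(gaussianReal (-M) a), P {ω | ∀ t ≤ T, X t ω ≤ -c - v} +
      P {ω | ∀ t ≤ T, (-X) t ω ≤ v - c} = ENNReal.ofReal (h v) := by
    -- The points `v = ±c` give level `0`, outside the strict inequality of
    -- `measure_forall_le_eq_zero`; they are null for the Gaussian law.
    have := nullSingletonClass_gaussianReal (μ := -M) ha.ne'
    have hne : ∀ x : ℝ, ∀ᵐ v ∂(gaussianReal (-M) a), v ≠ x := fun x => by simp [ae_iff]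
    filter_upwards [hne c, hne (-c)] with v hvc hvc'
    by_cases hv : v ∈ S
    · rcases lt_abs.1 (show c < |v| from hv) with hv' | hv'
      · have hva : |v| = v := abs_of_pos (hc.trans hv')
        rw [hXB.measure_forall_le_eq_zero T (by linarith), zero_add, hvalN v hv,
          ofReal_measureReal, hva]
      · have hva : |v| = -v := abs_of_neg (by linarith)
        rw [hNB.measure_forall_le_eq_zero T (by linarith), add_zero, hval v hv,
          ofReal_measureReal, hva, neg_sub_comm]
    · have hv1 := abs_le.1 (not_lt.1 (show ¬ c < |v| from hv))
      have hv2 := lt_of_le_of_ne hv1.2 hvc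
      have hv3 := lt_of_le_of_ne hv1.1 hvc'.symm
      rw [hXB.measure_forall_le_eq_zero T (by linarith),
        hNB.measure_forall_le_eq_zero T (by linarith), hh, Set.indicator_of_notMem hv]
      simp
  have hm₁ : Measurable fun v : ℝ => P {ω | ∀ t ≤ T, X t ω ≤ -c - v} := by
    refine Antitone.measurable fun v w hvw => ?_
    exact measure_mono fun ω hω t ht => (hω t ht).trans (by linarith)
  have hP : P {ω | c ≤ ⨅ t : Set.Icc a b, |W t ω - M|} =
      ENNReal.ofReal (∫ v, h v ∂(gaussianReal (-M) a)) := by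
    rw [measure_congr hev, measure_union hdisj hE₂m, hE₁, hE₂,
      measure_forall_le_comp_eq_lintegral hXm hXc hV hind T (g := fun v => -c - v) (by fun_prop),
      measure_forall_le_comp_eq_lintegral hNm hNc hV hindN T (g := fun v => v - c) (by fun_prop),
      hVlaw, ← lintegral_add_left hm₁, lintegral_congr_ae hsum,
      ofReal_integral_eq_lintegral_ofReal hintγ (ae_of_all _ h0)]
  refine ⟨(hE₁m.union hE₂m).nullMeasurableSet.congr hev.symm, ?_, ?_⟩
  · rw [hintegrand] at hint
    exact (integrable_indicator_iff hSm).1 hint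
  · rw [measureReal_def, hP, ENNReal.toReal_ofReal (integral_nonneg h0),
      integral_gaussianReal_eq_integral_smul ha.ne']
    simp only [smul_eq_mul]
    rw [hintegrand, integral_indicator hSm]
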